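/- All graphs are finite and simple, and a clique means an inclusion-maximal complete set of vertices. A graph is a block graph if each of its blocks (maximal connected subgraphs that remain connected after the removal of any single vertex) is complete. For $n\ge 1$, an $n$-clique path in a graph $H$ is a sequence of distinct cliques $B_1,\dots,B_n$ of $H$ such that $B_i\cap B_{i+1}=\{x_i\}$ is a single vertex for $1\le i\le n-1$ and $B_i\cap B_j=\emptyset$ for $j>i+1$; the vertices $x_1,\dots,x_{n-1}$ are its connecting vertices, and $V(P)=B_1\cup\dots\cup B_n$ is the vertex set of the clique path $P$. A connected graph $H$ is a $\mathcal T_2$-graph if it is a block graph and it contains a clique path $P=(B_1,\dots,B_n)$, with $n$ as large as possible among all clique paths in $H$, such that every clique $K$ of $H$ other than $B_1,\dots,B_n$ satisfies one of the following conditions: (a) $K\cap V(P)=\{x_i\}$ for some $1\le i\le n-1$; or (b) $K\cap V(P)=\emptyset$, and there is a clique $K'$ of $H$, other than $B_1,\dots,B_n$, that satisfies (a) and has $K\cap K'=\{y\}$ for some vertex $y$. A graph $G$ is a $\mathcal T_2$-graph if every connected component of $G$ is a $\mathcal T_2$-graph. For $r\ge 1$, $\mathrm{Ind}_r(G)$ is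 the simplicial complex of all $A\subseteq V(G)$ such that every connected component of the induced subgraph $G[A]$ has at most $r$ vertices. A (not necessarily pure) simplicial complex is shellable if its facets can be ordered $F_1,\dots,F_t$, without repetition, so that for every $k>1$ the complex $\langle F_k\rangle\cap\langle F_1,\dots,F_{k-1}\rangle$ is pure of dimension $\dim F_k-1$, where $\langle\cdot\rangle$ denotes the simplicial complex generated by the given faces. Theorem. If $G$ is a $\mathcal T_2$-graph, then $\mathrm{Ind}_4(G)$ is shellable. -/

import Mathlib

namespace BlockInd

/-! Simplicial complexes on a vertex set `V` are families of finite sets closed under taking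
subsets, that is `LowerSet (Finset V)`. The empty set is a face of every nonempty complex. -/

section Shellability

variable {V : Type*}

/-- Facets: faces that are maximal under inclusion. -/
def IsFacet (Δ : LowerSet (Finset V)) (F : Finset V) : Prop :=
  Maximal (fun E => E ∈ Δ) F

/-- `Δ` is pure of dimension `c - 1`: every facet has exactly `c` vertices. -/
def IsPureOfCard (Δ : LowerSet (Finset V)) (c : ℕ) : Prop :=
  ∀ E, IsFacet Δ E → E.card = c

/-- (Nonpure) shellability of a finite complex: the facets can be listed without repetition as
`F 0, …, F (t - 1)` so that for every `k ≠ 0` the complex `⟨F k⟩ ∩ ⟨F 0, …, F (k - 1)⟩` is pure of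
dimension `dim (F k) - 1`. Here `LowerSet.Iic F` is the complex generated by `F`. -/
def Shellable (Δ : LowerSet (Finset V)) : Prop :=
  ∃ (t : ℕ) (F : Fin t → Finset V),
    Function.Injective F ∧
    (∀ E, IsFacet Δ E ↔ ∃ k, F k = E) ∧
    ∀ k : Fin t, 0 < (k : ℕ) →
      IsPureOfCard (LowerSet.Iic (F k) ⊓ ⨆ j : {j : Fin t // j < k}, LowerSet.Iic (F j))
        ((F k).card - 1)

end Shellability

section Independence

variable {V : Type*}

/-- `A` is `r`-independent in `G`: every connected component of the induced subgraph `G[A]` has at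
most `r` vertices. -/
def IsRIndependent (G : SimpleGraph V) (r : ℕ) (A : Finset V) : Prop :=
  ∀ C : (G.induce (A : Set V)).ConnectedComponent, C.supp.ncard ≤ r

theorem IsRIndependent.mono {G : SimpleGraph V} {r : ℕ} {A B : Finset V} (hBA : B ⊆ A)
    (hA : IsRIndependent G r A) : IsRIndependent G r B := by
  intro C
  let f : G.induce (B : Set V) →g G.induce (A : Set V) :=
    { toFun := fun v => ⟨v.1, hBA v.2⟩
      map_rel' := fun h => h }
  refine le_trans ?_ (hA (C.map f))
  refine Set.ncard_le_ncard_of_injOn f ?_ ?_ (Set.toFinite _)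
  · rintro v rfl
    rfl
  · intro v _ w _ h
    have h2 : (f v).1 = (f w).1 := congrArg Subtype.val h
    exact Subtype.ext h2

/-- The `r`-independence complex `Ind_r(G)`. -/
def indComplex (G : SimpleGraph V) (r : ℕ) : LowerSet (Finset V) where
  carrier := {A | IsRIndependent G r A}
  lower' := fun _ _ hBA hA => IsRIndependent.mono hBA hA

end Independence

section BlockGraphs

variable {V : Type*}

/-- The subgraph induced on `W` is connected and stays connected when any one vertex is removed
(the empty graph left over from a single vertex counts as connected). -/
def IsNonseparable (G : SimpleGraph V) (W : Set V) : Prop :=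
  (G.induce W).Connected ∧ ∀ v ∈ W, (G.induce (W \ {v})).Preconnected

/-- Vertex sets of blocks. (A maximal nonseparable subgraph is an induced subgraph.) -/
def IsBlock (G : SimpleGraph V) (W : Set V) : Prop :=
  Maximal (IsNonseparable G) W

/-- Block graphs: every block is complete. -/
def IsBlockGraph (G : SimpleGraph V) : Prop :=
  ∀ W, IsBlock G W → G.IsClique W

/-- The cliques of `G` in the sense of maximal cliques: complete vertex sets that are maximal under
inclusion. In a block graph these are exactly the vertex sets of the blocks. -/
def IsMaxClique (G : SimpleGraph V) (K : Set V) : Prop :=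
  Maximal (fun S => G.IsClique S) K

/-- `B 0, …, B (n - 1)` is an `n`-clique path of `G` with connecting vertices
`x 0, …, x (n - 2)`: the `B i` are distinct cliques of `G`, consecutive ones share exactly one
vertex `x i`, and non-consecutive ones are disjoint. Values of `B` from `n` on and of `x` from
`n - 1` on play no role. -/
structure IsCliquePath (G : SimpleGraph V) (n : ℕ) (B : ℕ → Set V) (x : ℕ → V) : Prop where
  one_le : 1 ≤ n
  isMaxClique : ∀ i < n, IsMaxClique G (B i)
  distinct : ∀ i < n, ∀ j < n, B i = B j → i = j
  inter_succ : ∀ i, i + 1 < n → B i ∩ B (i + 1) = {x i}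
  disjoint : ∀ i j, i + 1 < j → j < n → Disjoint (B i) (B j)

/-- The vertex set of the clique path `B 0, …, B (n - 1)`. -/
def pathVerts (n : ℕ) (B : ℕ → Set V) : Set V :=
  {v | ∃ i < n, v ∈ B i}

/-- `K` is a clique of `G` that does not belong to the path `B 0, …, B (n - 1)` and meets it
exactly in one of the connecting vertices `x 0, …, x (n - 2)`. -/
def AttachedAtConnecting (G : SimpleGraph V) (n : ℕ) (B : ℕ → Set V) (x : ℕ → V)
    (K : Set V) : Prop :=
  IsMaxClique G K ∧ (∀ i < n, K ≠ B i) ∧ ∃ i, i + 1 < n ∧ K ∩ pathVerts n B = {x i}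

/-- Connected `T₂`-graphs. -/
def IsConnectedT2 (G : SimpleGraph V) : Prop :=
  G.Connected ∧ IsBlockGraph G ∧
    ∃ (n : ℕ) (B : ℕ → Set V) (x : ℕ → V),
      IsCliquePath G n B x ∧
      (∀ (m : ℕ) (B' : ℕ → Set V) (x' : ℕ → V), IsCliquePath G m B' x' → m ≤ n) ∧
      ∀ K, IsMaxClique G K → (∀ i < n, K ≠ B i) →
        AttachedAtConnecting G n B x K ∨
        (K ∩ pathVerts n B = ∅ ∧
          ∃ K', AttachedAtConnecting G n B x K' ∧ ∃ y, K ∩ K' = {y})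

/-- `T₂`-graphs: every connected component is a connected `T₂`-graph. -/
def IsT2 (G : SimpleGraph V) : Prop :=
  ∀ C : G.ConnectedComponent, IsConnectedT2 C.toSimpleGraph

end BlockGraphs

end BlockInd

namespace BlockInd

/-! ### Components inside a vertex subset, expressed by reachability. -/

section Reach

variable {V : Type*} {G : SimpleGraph V}

/-! The argument works for every `r` and every finite graph whose components are block graphs. It
builds a nonpure vertex decomposition. For `R ⊆ W`, consider the sets between `R` and `W` whose
components have at most `r` vertices. Deleting a vertex `x` removes it from `W`; passing to the link
of `x` adds it to `R`. Both operations stay in this family (`relIndComplex`), so induction reduces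
the theorem to `exists_isShedding`: if `R` has small components and `W` does not, some vertex of `W
\ R` is shedding.

To find it, take a component `X` with more than `r` vertices, as small as possible among those left
in `G[W]` by deleting one vertex `y ∉ R` (or any large component of `G[W]` if there are none).
Usually `X` is viewed from a connected hub: a component of `G[R]` meeting `X`, or `{y}`. Each
neighbour `z ∉ R` of the hub in `X` roots a branch, the part of `W` that `z` separates from the hub.
If a branch has more than `r` vertices, its root is shedding, because by minimality it falls into
small pieces once the root is deleted (`isShedding_of_cut`). Otherwise the root of a largest branch
is shedding: a vertex of another branch can be exchanged for this branch without enlarging a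
component beyond `r` (`isShedding_of_pieces`).

Block graphs enter only through `NeighborsClosed`, which forces the surroundings of all roots into
one component. -/

/-- The graph on all of `V` whose edges are the edges of `G` with both ends in `W`. -/
def within (G : SimpleGraph V) (W : Set V) : SimpleGraph V where
  Adj a b := G.Adj a b ∧ a ∈ W ∧ b ∈ W
  symm := ⟨fun _ _ h => ⟨h.1.symm, h.2.2, h.2.1⟩⟩
  loopless := ⟨fun _ h => h.1.ne rfl⟩

/-- The vertices that can be reached from `v` inside `W`; this is `{v}` if `v ∉ W`. -/
def reachSet (G : SimpleGraph V) (W : Set V) (v : V) : Set V :=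
  {u | (within G W).Reachable v u}

theorem mem_reachSet_self (W : Set V) (v : V) : v ∈ reachSet G W v :=
  SimpleGraph.Reachable.refl v

theorem reachSet_symm {W : Set V} {u v : V} (h : u ∈ reachSet G W v) : v ∈ reachSet G W u :=
  SimpleGraph.Reachable.symm h

theorem reachSet_trans {W : Set V} {u v w : V} (h : u ∈ reachSet G W v)
    (h' : w ∈ reachSet G W u) : w ∈ reachSet G W v :=
  SimpleGraph.Reachable.trans h h'

theorem reachSet_step {W : Set V} {u v w : V} (h : u ∈ reachSet G W v) (hu : u ∈ W) (hw : w ∈ W)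
    (huw : G.Adj u w) : w ∈ reachSet G W v :=
  reachSet_trans h (SimpleGraph.Adj.reachable ⟨huw, hu, hw⟩)

theorem reachSet_mono {W W' : Set V} (h : W ⊆ W') (v : V) : reachSet G W v ⊆ reachSet G W' v :=
  fun _ hu => SimpleGraph.Reachable.mono
    (show within G W ≤ within G W' from fun _ _ e => ⟨e.1, h e.2.1, h e.2.2⟩) hu

theorem reachSet_eq {W : Set V} {u v : V} (h : u ∈ reachSet G W v) :
    reachSet G W u = reachSet G W v :=
  Set.Subset.antisymm (fun _ hw => reachSet_trans h hw)
    (fun _ hw => reachSet_trans (reachSet_symm h) hw)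

theorem reachSet_subset_of_closed {W S : Set V} {v : V} (hv : v ∈ S)
    (hS : ∀ a ∈ S, a ∈ W → ∀ b ∈ W, G.Adj a b → b ∈ S) : reachSet G W v ⊆ S := by
  rintro u ⟨p⟩
  induction p with
  | nil => exact hv
  | cons h _ ih => exact ih (hS _ hv h.2.1 _ h.2.2 h.1)

theorem reachSet_subset {W : Set V} {v : V} (hv : v ∈ W) : reachSet G W v ⊆ W :=
  reachSet_subset_of_closed hv fun _ _ _ _ hb _ => hb

/-- Inside its own reach set a vertex still reaches everything. -/
theorem reachSet_reachSet {W : Set V} {v : V} (hv : v ∈ W) :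
    reachSet G W v ⊆ reachSet G (reachSet G W v) v := by
  refine reachSet_subset_of_closed (mem_reachSet_self _ _) fun a ha haW b hb hab => ?_
  have haR : a ∈ reachSet G W v := reachSet_mono (reachSet_subset hv) v ha
  exact reachSet_step ha haR (reachSet_step haR haW hb hab) hab

/-- Every component of `G[A]` has at most `r` vertices, in terms of reach sets. -/
def SmallComps (G : SimpleGraph V) (r : ℕ) (A : Set V) : Prop :=
  ∀ v ∈ A, (reachSet G A v).ncard ≤ r

theorem isRIndependent_iff {r : ℕ} {A : Finset V} :
    IsRIndependent G r A ↔ SmallComps G r (A : Set V) := by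
  have key : ∀ v : (A : Set V),
      ((G.induce (A : Set V)).connectedComponentMk v).supp.ncard
        = (reachSet G (A : Set V) v).ncard := by
    intro v
    rw [← Set.ncard_image_of_injective _ Subtype.val_injective]
    congr 1
    apply Set.Subset.antisymm
    · rintro _ ⟨u, hu, rfl⟩
      have hu' : (G.induce (A : Set V)).Reachable v u :=
        (SimpleGraph.ConnectedComponent.exact hu).symm
      let f : G.induce (A : Set V) →g within G (A : Set V) :=
        { toFun := Subtype.val
          map_rel' := fun {a b} h => ⟨h, a.2, b.2⟩ }
      exact hu'.map f
    · refine reachSet_subset_of_closed ⟨v, rfl, rfl⟩ ?_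
      rintro _ ⟨a, ha, rfl⟩ - b hb hab
      refine ⟨⟨b, hb⟩, ?_, rfl⟩
      rw [SimpleGraph.ConnectedComponent.mem_supp_iff] at ha ⊢
      rw [← ha]
      exact SimpleGraph.ConnectedComponent.sound
        (SimpleGraph.Adj.reachable (G := G.induce (A : Set V)) hab.symm)
  constructor
  · intro h v hv
    rw [← key ⟨v, hv⟩]
    exact h _
  · intro h C
    induction C using SimpleGraph.ConnectedComponent.ind with
    | h v => exact (key v).trans_le (h v v.2)

theorem SmallComps.mono [Finite V] {r : ℕ} {A B : Set V} (hAB : A ⊆ B) (h : SmallComps G r B) :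
    SmallComps G r A :=
  fun v hv => (Set.ncard_le_ncard (reachSet_mono hAB v) (Set.toFinite _)).trans (h v (hAB hv))

/-- Adding `u` alters only the component that contains `u`; every other component of the larger set
is already connected inside `A`. -/
theorem SmallComps.insert [Finite V] {r : ℕ} {A : Set V} {u : V} (h : SmallComps G r A)
    (hu : (reachSet G (insert u A) u).ncard ≤ r) : SmallComps G r (insert u A) := by
  intro v hv
  by_cases huv : u ∈ reachSet G (Insert.insert u A) v
  · rwa [← reachSet_eq huv]
  · have hvA : v ∈ A := by
      rcases hv with rfl | hv
      · exact absurd (mem_reachSet_self _ _) huv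
      · exact hv
    refine (Set.ncard_le_ncard ?_ (Set.toFinite _)).trans (h v hvA)
    have hA : ∀ b ∈ reachSet G (Insert.insert u A) v, b ∈ A := by
      intro b hb
      rcases reachSet_subset hv hb with rfl | hb'
      · exact absurd hb huv
      · exact hb'
    have : reachSet G (Insert.insert u A) v ⊆
        {b | b ∈ reachSet G A v ∧ b ∈ reachSet G (Insert.insert u A) v} := by
      refine reachSet_subset_of_closed ⟨mem_reachSet_self _ _, mem_reachSet_self _ _⟩ ?_
      rintro a ⟨ha, ha'⟩ haW b hb hab
      have hb' := reachSet_step ha' haW hb hab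
      exact ⟨reachSet_step ha (hA a ha') (hA b hb') hab, hb'⟩
    exact fun b hb => (this hb).1

end Reach

/-! ### Block graphs: neighbours of a vertex joined around it are adjacent. -/

section BlockGraph

variable {V : Type*} {G : SimpleGraph V}

/-- Two neighbours of `x` that are joined by a path avoiding `x` are equal or adjacent. -/
def NeighborsClosed (G : SimpleGraph V) : Prop :=
  ∀ (W : Set V) (x a b : V), x ∉ W → G.Adj x a → G.Adj x b → b ∈ reachSet G W a →
    a = b ∨ G.Adj a b

theorem exists_walk_of_mem_reachSet {W : Set V} {a b : V} (h : b ∈ reachSet G W a) :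
    ∃ p : G.Walk a b, ∀ u ∈ p.support, u = a ∨ u ∈ W := by
  have : reachSet G W a ⊆ {b | ∃ p : G.Walk a b, ∀ u ∈ p.support, u = a ∨ u ∈ W} := by
    refine reachSet_subset_of_closed ⟨.nil, by simp⟩ ?_
    rintro c ⟨p, hp⟩ - d hd hcd
    refine ⟨p.concat hcd, fun u hu => ?_⟩
    rw [SimpleGraph.Walk.support_concat, List.mem_append, List.mem_singleton] at hu
    rcases hu with hu | rfl
    · exact hp u hu
    · exact Or.inr hd
  exact this h

/-- On a path, a vertex `u` can be joined to one of the ends without using a given other vertex. -/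
theorem notMem_takeUntil_or_dropUntil [DecidableEq V] {a b u v : V} {p : G.Walk a b}
    (hp : p.IsPath) (hu : u ∈ p.support) (huv : u ≠ v) :
    v ∉ (p.takeUntil u hu).support ∨ v ∉ (p.dropUntil u hu).support := by
  by_contra! h
  have hnd : ((p.takeUntil u hu).append (p.dropUntil u hu)).support.Nodup := by
    rw [p.take_spec hu]
    exact hp.support_nodup
  rw [SimpleGraph.Walk.support_append] at hnd
  have hv : v ∈ (p.dropUntil u hu).support.tail := by
    rcases (SimpleGraph.Walk.mem_support_iff _).1 h.2 with h' | h'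
    · exact absurd h'.symm huv
    · exact h'
  exact (List.nodup_append.1 hnd).2.2 v h.1 v hv rfl

/-- A path together with a vertex adjacent to both of its ends is nonseparable. -/
theorem isNonseparable_insert_support {x a b : V} {p : G.Walk a b} (hp : p.IsPath)
    (hx : x ∉ p.support) (ha : G.Adj x a) (hb : G.Adj x b) :
    IsNonseparable G (insert x {u | u ∈ p.support}) := by
  classical
  -- It suffices that every path vertex in `T` can run along the path to one of its ends inside `T`,
  -- since `x` is adjacent to both ends.
  have key : ∀ T : Set V, x ∈ T → T ⊆ insert x {u | u ∈ p.support} →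
      (∀ u (hu : u ∈ p.support), u ∈ T → (∀ w ∈ (p.takeUntil u hu).support, w ∈ T) ∨
        ∀ w ∈ (p.dropUntil u hu).support, w ∈ T) → (G.induce T).Connected := by
    intro T hxT hT h
    have hreach : ∀ u : T, (G.induce T).Reachable ⟨x, hxT⟩ u := by
      rintro ⟨u, huT⟩
      rcases hT huT with rfl | hu
      · exact SimpleGraph.Reachable.refl _
      · rcases h u hu huT with h | h
        · have hstep : (G.induce T).Adj ⟨x, hxT⟩ ⟨a, h a (SimpleGraph.Walk.start_mem_support _)⟩ :=
            ha
          exact hstep.reachable.trans ⟨(p.takeUntil u hu).induce T h⟩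
        · have hstep : (G.induce T).Adj ⟨x, hxT⟩ ⟨b, h b (SimpleGraph.Walk.end_mem_support _)⟩ :=
            hb
          exact hstep.reachable.trans (SimpleGraph.Reachable.symm ⟨(p.dropUntil u hu).induce T h⟩)
    have : Nonempty T := ⟨⟨x, hxT⟩⟩
    exact ⟨fun u v => (hreach u).symm.trans (hreach v)⟩
  refine ⟨key _ (Set.mem_insert _ _) subset_rfl fun u hu _ => Or.inl fun w hw =>
    Or.inr (p.support_takeUntil_subset_support hu hw), fun v _ => ?_⟩
  by_cases hvx : v = x
  · subst hvx
    have : insert v {u | u ∈ p.support} \ {v} = {u | u ∈ p.support} := by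
      ext u
      simp only [Set.mem_sdiff, Set.mem_insert_iff, Set.mem_ofPred_eq, Set.mem_singleton_iff]
      constructor
      · rintro ⟨h | h, h'⟩
        · exact absurd h h'
        · exact h
      · intro h
        exact ⟨Or.inr h, fun h' => hx (h' ▸ h)⟩
    rw [this]
    exact p.connected_induce_support.preconnected
  · have hx' : x ∈ insert x {u | u ∈ p.support} \ {v} :=
      ⟨Set.mem_insert _ _, fun h => hvx h.symm⟩
    refine (key _ hx' Set.sdiff_subset
      fun u hu huT => ?_).preconnected
    rcases notMem_takeUntil_or_dropUntil hp hu (v := v) huT.2 with h | h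
    · exact Or.inl fun w hw => ⟨Or.inr (p.support_takeUntil_subset_support hu hw),
        fun h' => h (h' ▸ hw)⟩
    · exact Or.inr fun w hw => ⟨Or.inr (p.support_dropUntil_subset_support hu hw),
        fun h' => h (h' ▸ hw)⟩

/-- After shortening the walk to a path, `x` closes it to a cycle (or an edge or triangle). This is
nonseparable, so it lies in a block, which is complete. -/
theorem IsBlockGraph.eq_or_adj [Finite V] (hG : IsBlockGraph G) {x a b : V} (p : G.Walk a b)
    (hx : x ∉ p.support) (ha : G.Adj x a) (hb : G.Adj x b) : a = b ∨ G.Adj a b := by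
  classical
  have hx' : x ∉ p.bypass.support := fun h => hx (p.support_bypass_subset_support h)
  obtain ⟨B, hle, hB⟩ := (Set.toFinite {W | IsNonseparable G W}).exists_le_maximal
    (isNonseparable_insert_support p.bypass_isPath hx' ha hb)
  by_cases hab : a = b
  · exact Or.inl hab
  · exact Or.inr (hG B hB (hle (Or.inr (SimpleGraph.Walk.start_mem_support _)))
      (hle (Or.inr (SimpleGraph.Walk.end_mem_support _))) hab)

theorem neighborsClosed_of_components [Finite V]
    (hG : ∀ C : G.ConnectedComponent, IsBlockGraph C.toSimpleGraph) : NeighborsClosed G := by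
  intro W x a b hxW ha hb hab
  obtain ⟨p, hp⟩ := exists_walk_of_mem_reachSet hab
  have hx : x ∉ p.support := fun h => by
    rcases hp x h with h | h
    · exact ha.ne h
    · exact hxW h
  have hC : ∀ u ∈ p.support, u ∈ (G.connectedComponentMk x).supp := by
    classical
    intro u hu
    exact SimpleGraph.ConnectedComponent.sound
      (ha.reachable.trans (p.takeUntil u hu).reachable).symm
  have hB : IsBlockGraph (G.induce (G.connectedComponentMk x).supp) := hG _
  have hx' : (⟨x, rfl⟩ : (G.connectedComponentMk x).supp) ∉ (p.induce _ hC).support := fun h => by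
    rw [SimpleGraph.Walk.support_induce] at h
    exact hx (by simpa using h)
  rcases hB.eq_or_adj _ hx' ha hb with h | h
  · exact Or.inl (congrArg Subtype.val h)
  · exact Or.inr h

end BlockGraph

/-! ### Existence of a shedding vertex. -/

section Shedding

variable {V : Type*} {G : SimpleGraph V}

/-- `x` is a shedding vertex of the complex of all `A` between `R` and `W` whose components have at
most `r` vertices: no facet of the link of `x` is a facet of the deletion of `x`. -/
def IsShedding (G : SimpleGraph V) (r : ℕ) (W R : Set V) (x : V) : Prop :=
  x ∈ W ∧ x ∉ R ∧ ∀ A, R ⊆ A → A ⊆ W → x ∉ A → SmallComps G r (insert x A) →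
    ∃ u ∈ W, u ∉ A ∧ u ≠ x ∧ SmallComps G r (insert u A)

/-- Since `insert y S` is connected and too large, a face containing `y` misses some `u ∈ S`. Once
`y` is dropped, `u` can be added: its component lies inside a component of `G[W \ {y}]`, which is
small. -/
theorem isShedding_of_cut [Finite V] {r : ℕ} {W R S : Set V} {y : V} (hyW : y ∈ W) (hyR : y ∉ R)
    (hyS : y ∉ S) (hSW : S ⊆ W) (hconn : S ⊆ reachSet G (insert y S) y)
    (hsmall : ∀ v ∈ S, (reachSet G (W \ {y}) v).ncard ≤ r) (hcard : r < (insert y S).ncard) :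
    IsShedding G r W R y := by
  refine ⟨hyW, hyR, fun A hRA hAW hyA hA => ?_⟩
  have : ∃ u ∈ S, u ∉ A := by
    by_contra! hSA
    have hsub : insert y S ⊆ reachSet G (insert y A) y := by
      rintro v (rfl | hv)
      · exact mem_reachSet_self _ _
      · exact reachSet_mono (Set.insert_subset_insert hSA) y (hconn hv)
    have := Set.ncard_le_ncard hsub (Set.toFinite _)
    have := hA y (Set.mem_insert _ _)
    omega
  obtain ⟨u, huS, huA⟩ := this
  have huy : u ≠ y := fun h => hyS (h ▸ huS)
  refine ⟨u, hSW huS, huA, huy, (hA.mono (Set.subset_insert _ _)).insert ?_⟩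
  refine (Set.ncard_le_ncard (reachSet_mono ?_ u) (Set.toFinite _)).trans (hsmall u huS)
  rintro v (rfl | hv)
  · exact ⟨hSW huS, huy⟩
  · exact ⟨hAW hv, fun h => hyA (h ▸ hv)⟩

/-- The vertices that `z` separates from `p` in `G[W]`, together with `z`. -/
def branch (G : SimpleGraph V) (W : Set V) (p z : V) : Set V :=
  reachSet G W p \ reachSet G (W \ {z}) p

theorem mem_branch_self {W : Set V} {p z : V} (hp : p ∈ W) (hzp : z ≠ p)
    (hz : z ∈ reachSet G W p) : z ∈ branch G W p z :=
  ⟨hz, fun h => (reachSet_subset (show p ∈ W \ {z} from ⟨hp, hzp.symm⟩) h).2 rfl⟩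

theorem branch_subset {W : Set V} {p z : V} (hp : p ∈ W) : branch G W p z ⊆ W :=
  fun _ h => reachSet_subset hp h.1

theorem branch_step {W : Set V} {p z a b : V} (hp : p ∈ W) (ha : a ∈ branch G W p z) (haz : a ≠ z)
    (hb : b ∈ W) (hab : G.Adj a b) (hz : z ∈ branch G W p z) : b ∈ branch G W p z := by
  have haW := branch_subset hp ha
  refine ⟨reachSet_step ha.1 haW hb hab, fun hb' => ?_⟩
  have hbz : b ≠ z := fun h => hz.2 (h ▸ hb')
  exact ha.2 (reachSet_step hb' ⟨hb, hbz⟩ ⟨haW, haz⟩ hab.symm)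

theorem mem_reachSet_of_adj_of_notMem_branch {W : Set V} {p z b : V} (hp : p ∈ W)
    (hz : z ∈ reachSet G W p) (hb : b ∈ W) (hzb : G.Adj z b) (h : b ∉ branch G W p z) :
    b ∈ reachSet G (W \ {z}) p := by
  by_contra h'
  exact h ⟨reachSet_step hz (reachSet_subset hp hz) hb hzb, h'⟩

/-- A walk from `p` can enter the branch only through `z`, so the vertices reached from `z` within
the branch and those reached from `p` without `z` form a set closed under steps in `W`. -/
theorem branch_subset_reachSet {W : Set V} {p z : V} (hz : z ∈ branch G W p z) :
    branch G W p z ⊆ reachSet G (branch G W p z) z := by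
  have key : reachSet G W p ⊆
      reachSet G (branch G W p z) z ∪ reachSet G (W \ {z}) p := by
    refine reachSet_subset_of_closed (Or.inr (mem_reachSet_self _ _)) ?_
    rintro a (ha | ha) haW b hb hab
    · have haB : a ∈ branch G W p z := reachSet_subset hz ha
      by_cases hbB : b ∈ branch G W p z
      · exact Or.inl (reachSet_step ha haB hbB hab)
      · refine Or.inr ?_
        by_contra h
        exact hbB ⟨reachSet_step haB.1 haW hb hab, h⟩
    · by_cases hbz : b = z
      · exact Or.inl (hbz ▸ mem_reachSet_self _ _)
      · refine Or.inr (reachSet_step ha ⟨haW, ?_⟩ ⟨hb, hbz⟩ hab)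
        exact fun h => hz.2 (h ▸ ha)
  exact fun v hv => (key hv.1).resolve_right hv.2

/-- A root of a largest one among a family of small pendant pieces is shedding, provided that the
pieces cannot all be chosen and that the surroundings of their roots merge with it. -/
theorem isShedding_of_pieces [Finite V] {r : ℕ} {W R Z : Set V} {z₀ : V} (D : V → Set V)
    (hZW : Z ⊆ W) (hZR : z₀ ∉ R) (hz₀ : z₀ ∈ Z) (hDW : ∀ z ∈ Z, D z ⊆ W)
    (hclosed : ∀ z ∈ Z, ∀ a ∈ D z, a ≠ z → ∀ b ∈ W, G.Adj a b → b ∈ D z)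
    (hconn : D z₀ ⊆ reachSet G (D z₀) z₀) (hsmall : ∀ z ∈ Z, (D z).ncard ≤ r)
    (hmax : ∀ z ∈ Z, (D z).ncard ≤ (D z₀).ncard) (hdisj : ∀ z ∈ Z, z ≠ z₀ → z ∉ D z₀)
    (hnear : ∀ A, R ⊆ A → A ⊆ W → ∀ z ∈ Z, ∀ a ∈ A, G.Adj z a → a ∉ D z →
      a ∈ reachSet G (insert z₀ A) z₀)
    (hall : ∀ A, R ⊆ A → A ⊆ W → SmallComps G r (insert z₀ A) →
      ∃ z ∈ Z, ¬ D z ⊆ insert z₀ A) :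
    IsShedding G r W R z₀ := by
  refine ⟨hZW hz₀, hZR, fun A hRA hAW hzA hA => ?_⟩
  have hA' := hA.mono (Set.subset_insert z₀ A)
  suffices ∃ u ∈ W, u ∉ insert z₀ A ∧ (reachSet G (insert u A) u).ncard ≤ r by
    obtain ⟨u, huW, hu, hc⟩ := this
    exact ⟨u, huW, fun h => hu (Or.inr h), fun h => hu (Or.inl h), hA'.insert hc⟩
  -- If `D z₀` is not fully chosen, a missing vertex of it can be added: without `z₀` its component
  -- cannot leave `D z₀`.
  by_cases h0 : D z₀ ⊆ insert z₀ A
  swap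
  · obtain ⟨u, hu, huA⟩ := Set.not_subset.1 h0
    have hne : u ≠ z₀ := fun h => huA (Or.inl h)
    refine ⟨u, hDW _ hz₀ hu, huA,
      (Set.ncard_le_ncard ?_ (Set.toFinite _)).trans (hsmall z₀ hz₀)⟩
    refine reachSet_subset_of_closed hu fun a ha haA b hb hab => ?_
    refine hclosed z₀ hz₀ a ha ?_ b ?_ hab
    · rintro rfl
      rcases haA with h | h
      · exact hne h.symm
      · exact hzA h
    · rcases hb with rfl | hb
      · exact hDW _ hz₀ hu
      · exact hAW hb
  obtain ⟨z, hzZ, hz⟩ := hall A hRA hAW hA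
  obtain ⟨u, hu, huA⟩ := Set.not_subset.1 hz
  have hzz : z ≠ z₀ := fun h => hz (h ▸ h0)
  refine ⟨u, hDW _ hzZ hu, huA, ?_⟩
  set K := reachSet G (insert z₀ A) z₀ with hK
  have hKA : K ⊆ insert z₀ A := reachSet_subset (Set.mem_insert _ _)
  have hDK : D z₀ ⊆ K := fun v hv => reachSet_mono h0 z₀ (hconn hv)
  -- The exchange: the new component may fill `D z` and continue into `K`, but it loses all of `D
  -- z₀`, as `z₀` is absent. Since `D z₀` is a largest piece, the size is at most that of `K`, hence
  -- at most `r`.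
  have hsub : reachSet G (insert u A) u ⊆ D z ∪ K \ D z₀ := by
    refine reachSet_subset_of_closed (Or.inl hu) fun a ha haA b hb hab => ?_
    have haW : a ∈ W := by
      rcases haA with rfl | h
      · exact hDW _ hzZ hu
      · exact hAW h
    by_cases hbD : b ∈ D z
    · exact Or.inl hbD
    have hbA : b ∈ A := hb.resolve_left fun h => hbD (h ▸ hu)
    have hbz : b ≠ z₀ := fun h => hzA (h ▸ hbA)
    have hout : a ∉ D z₀ → b ∉ D z₀ := fun h hb' =>
      h (hclosed z₀ hz₀ b hb' hbz a haW hab.symm)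
    rcases ha with ha | ⟨ha, ha'⟩
    · by_cases haz : a = z
      · subst haz
        exact Or.inr ⟨hnear A hRA hAW a hzZ b hbA hab hbD, hout (hdisj a hzZ hzz)⟩
      · exact absurd (hclosed z hzZ a ha haz b (hAW hbA) hab) hbD
    · exact Or.inr ⟨reachSet_step ha (hKA ha) (Or.inr hbA) hab, hout ha'⟩
  have h1 := Set.ncard_le_ncard hsub (Set.toFinite _)
  have h2 := Set.ncard_union_le (D z) (K \ D z₀)
  have h3 := Set.ncard_sdiff_add_ncard_of_subset hDK (Set.toFinite _)
  have h4 := hmax z hzZ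
  have h5 := hA z₀ (Set.mem_insert _ _)
  rw [← hK] at h5
  omega

/-- In a large connected set `X` that is minimal in the sense of `hmin`, the branches at a hub `H`
contain a shedding vertex. -/
theorem exists_isShedding_of_hub [Finite V] (hG : NeighborsClosed G) {r : ℕ} {W R X H : Set V}
    {p : V} (hR : SmallComps G r R) (hXW : X ⊆ W) (hXconn : ∀ v ∈ X, X ⊆ reachSet G X v)
    (hXcard : r < X.ncard)
    (hmin : ∀ z ∈ W, z ∉ R → ∀ v ∈ W, v ≠ z → reachSet G (W \ {z}) v ⊂ X →
      (reachSet G (W \ {z}) v).ncard ≤ r)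
    (hp : p ∈ H) (hHW : H ⊆ W) (hH : H ⊆ reachSet G H p)
    (hHR : ∀ h ∈ H, ∀ z ∈ X, G.Adj h z → z ∉ H → z ∉ R)
    (hHX : ∃ v ∈ X, v ∈ H ∨ ∃ h ∈ H, G.Adj h v)
    (hbranch : ∀ z ∈ X, z ∉ H → (∃ h ∈ H, G.Adj h z) → branch G W p z ⊆ X)
    (hkind : H ⊆ R ∨ Disjoint H X ∧ ∀ z ∈ X, ∀ z' ∈ X, (∃ h ∈ H, G.Adj h z) →
      (∃ h ∈ H, G.Adj h z') → z ≠ z' → G.Adj z z') :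
    ∃ x, IsShedding G r W R x := by
  set Z : Set V := {z | z ∈ X ∧ z ∉ H ∧ ∃ h ∈ H, G.Adj h z} with hZ
  have hpW := hHW hp
  have hHz : ∀ z ∈ Z, H ⊆ reachSet G (W \ {z}) p := fun z hz h hh => by
    have hsub : H ⊆ W \ {z} := fun v hv => ⟨hHW hv, fun h => hz.2.1 (h ▸ hv)⟩
    exact reachSet_mono hsub p (hH hh)
  have hzp : ∀ z ∈ Z, z ≠ p := fun z hz h => hz.2.1 (h ▸ hp)
  have hzr : ∀ z ∈ Z, z ∈ reachSet G W p := by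
    rintro z ⟨hzX, hzH, h, hh, hhz⟩
    exact reachSet_step (reachSet_mono hHW p (hH hh)) (hHW hh) (hXW hzX) hhz
  have hself : ∀ z ∈ Z, z ∈ branch G W p z := fun z hz =>
    mem_branch_self hpW (hzp z hz) (hzr z hz)
  have hother : ∀ z ∈ Z, ∀ z' ∈ Z, z' ≠ z → z' ∈ reachSet G (W \ {z}) p := by
    intro z hz z' hz' hne
    obtain ⟨hX', -, h, hh, hhz'⟩ := hz'
    exact reachSet_step (hHz z hz hh) ⟨hHW hh, fun h' => hz.2.1 (h' ▸ hh)⟩ ⟨hXW hX', hne⟩ hhz'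
  -- A branch that is too large makes its root a cut vertex as in `isShedding_of_cut`; smallness of
  -- the remaining pieces comes from `hmin`, as they lie in `X` and miss `z`.
  by_cases hbig : ∃ z ∈ Z, r < (branch G W p z).ncard
  · obtain ⟨z, hz, hzr⟩ := hbig
    have hins : insert z (branch G W p z \ {z}) = branch G W p z :=
      Set.insert_sdiff_self_of_mem (hself z hz)
    obtain ⟨hzX, hzH, h, hh, hhz⟩ := id hz
    refine ⟨z, isShedding_of_cut (S := branch G W p z \ {z}) (hXW hzX) (hHR h hh z hzX hhz hzH)
      (fun h => h.2 rfl) (fun v hv => branch_subset hpW hv.1) ?_ ?_ ?_⟩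
    · rw [hins]
      exact fun v hv => branch_subset_reachSet (hself z hz) hv.1
    · intro v hv
      refine hmin z (hXW hzX) (hHR h hh z hzX hhz hzH) v (branch_subset hpW hv.1) hv.2 ?_
      have hsub : reachSet G (W \ {z}) v ⊆ branch G W p z \ {z} :=
        reachSet_subset_of_closed hv fun a ha haW b hb hab =>
          ⟨branch_step hpW ha.1 ha.2 hb.1 hab (hself z hz), hb.2⟩
      refine ⟨fun a ha => hbranch z hzX hzH ⟨h, hh, hhz⟩ (hsub ha).1, fun hX => ?_⟩
      exact (hsub (hX hzX)).2 rfl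
    · rwa [hins]
  push Not at hbig
  -- A step leaving a branch starts at its root `z`. Its endpoint `b` and a hub neighbour `h` of `z`
  -- are joined without `z`, so `b` is `h` or adjacent to `h`.
  have hcover : ∀ v ∈ X, v ∈ H ∨ ∃ z ∈ Z, v ∈ branch G W p z := by
    have hstart : ∀ b ∈ X, (∃ h ∈ H, G.Adj h b) → b ∈ H ∨ ∃ z ∈ Z, b ∈ branch G W p z := by
      intro b hb hadj
      by_cases hbH : b ∈ H
      · exact Or.inl hbH
      · have hbZ : b ∈ Z := ⟨hb, hbH, hadj⟩
        exact Or.inr ⟨b, hbZ, hself b hbZ⟩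
    obtain ⟨v₀, hv₀, hv₀'⟩ := hHX
    have hcl : reachSet G X v₀ ⊆ {v | v ∈ H ∨ ∃ z ∈ Z, v ∈ branch G W p z} := by
      refine reachSet_subset_of_closed (hv₀'.elim Or.inl (hstart v₀ hv₀)) ?_
      rintro a (ha | ⟨z, hz, ha⟩) haX b hb hab
      · exact hstart b hb ⟨a, ha, hab⟩
      · by_cases hbB : b ∈ branch G W p z
        · exact Or.inr ⟨z, hz, hbB⟩
        by_cases haz : a = z
        · subst haz
          have hb' := mem_reachSet_of_adj_of_notMem_branch hpW (hzr a hz) (hXW hb) hab hbB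
          obtain ⟨-, -, h, hh, hha⟩ := id hz
          have hhb : h ∈ reachSet G (W \ {a}) b :=
            reachSet_trans (reachSet_symm hb') (hHz a hz hh)
          rcases hG _ a b h (fun h => h.2 rfl) hab hha.symm hhb with h' | h'
          · exact Or.inl (h' ▸ hh)
          · exact hstart b hb ⟨h, hh, h'.symm⟩
        · exact absurd (branch_step hpW ha haz (hXW hb) hab (hself z hz)) hbB
    exact fun v hv => hcl (hXconn v₀ hv₀ hv)
  obtain ⟨v₀, hv₀, -⟩ := id hHX
  have hne : Z.Nonempty := by
    by_contra hemp
    have hXH : X ⊆ H := fun v hv => (hcover v hv).resolve_right fun ⟨z, hz, _⟩ => hemp ⟨z, hz⟩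
    rcases hkind with hHR' | ⟨hd, -⟩
    · have h1 := Set.ncard_le_ncard ((hXconn v₀ hv₀).trans (reachSet_mono (hXH.trans hHR') v₀))
        (Set.toFinite _)
      have h2 := hR v₀ (hHR' (hXH hv₀))
      omega
    · exact Set.disjoint_left.1 hd (hXH hv₀) hv₀
  obtain ⟨z₀, hz₀, hmax⟩ := Set.exists_max_image Z (fun z => (branch G W p z).ncard)
    (Set.toFinite _) hne
  obtain ⟨hz₀X, hz₀H, h₀, hh₀, hadj₀⟩ := id hz₀
  refine ⟨z₀, isShedding_of_pieces (branch G W p) (fun z hz => hXW hz.1)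
    (hHR h₀ hh₀ z₀ hz₀X hadj₀ hz₀H) hz₀ (fun z _ => branch_subset hpW)
    (fun z hz a ha haz b hb hab => branch_step hpW ha haz hb hab (hself z hz))
    (branch_subset_reachSet (hself z₀ hz₀)) hbig hmax
    (fun z hz hne' h => h.2 (hother z₀ hz₀ z hz hne')) ?_ ?_⟩
  · intro A hRA hAW z hz a haA hza haB
    have ha' := mem_reachSet_of_adj_of_notMem_branch hpW (hzr z hz) (hAW haA) hza haB
    -- A hub inside `R` belongs to every face and links `z₀` to `a`. In the other case the hub may
    -- be missing from `A`, and adjacency of the roots provides the link.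
    rcases hkind with hHR' | ⟨-, hcl⟩
    · obtain ⟨-, -, h, hh, hhz⟩ := id hz
      have hHA : H ⊆ insert z₀ A := fun v hv => Or.inr (hRA (hHR' hv))
      have hreach : h ∈ reachSet G (insert z₀ A) z₀ := by
        refine reachSet_trans (reachSet_step (mem_reachSet_self _ z₀) (Set.mem_insert _ _)
          (hHA hh₀) hadj₀.symm) ?_
        exact reachSet_mono hHA _ (reachSet_trans (reachSet_symm (hH hh₀)) (hH hh))
      have hah : h ∈ reachSet G (W \ {z}) a :=
        reachSet_trans (reachSet_symm ha') (hHz z hz hh)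
      rcases hG _ z a h (fun h => h.2 rfl) hza hhz.symm hah with rfl | h'
      · exact hreach
      · exact reachSet_step hreach (hHA hh) (Or.inr haA) h'.symm
    · by_cases hzz : z = z₀
      · subst hzz
        exact reachSet_step (mem_reachSet_self _ _) (Set.mem_insert _ _) (Or.inr haA) hza
      · have haz₀ : z₀ ∈ reachSet G (W \ {z}) a :=
          reachSet_trans (reachSet_symm ha') (hother z hz z₀ hz₀ (Ne.symm hzz))
        have hzz₀ := hcl z hz.1 z₀ hz₀X hz.2.2 hz₀.2.2 hzz
        rcases hG _ z a z₀ (fun h => h.2 rfl) hza hzz₀ haz₀ with rfl | h'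
        · exact mem_reachSet_self _ _
        · exact reachSet_step (mem_reachSet_self _ _) (Set.mem_insert _ _) (Or.inr haA) h'.symm
  -- If all branches were chosen, the face would contain `X`, a connected set with more than `r`
  -- vertices.
  · intro A hRA hAW hA
    by_contra! hsub
    have hXA : X ⊆ insert z₀ A := by
      intro v hv
      rcases hcover v hv with hvH | ⟨z, hz, hvz⟩
      · rcases hkind with hHR' | ⟨hd, -⟩
        · exact Or.inr (hRA (hHR' hvH))
        · exact absurd hv (Set.disjoint_left.1 hd hvH)
      · exact hsub z hz hvz
    have h1 := Set.ncard_le_ncard ((hXconn z₀ hz₀X).trans (reachSet_mono hXA z₀)) (Set.toFinite _)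
    have h2 := hA z₀ (Set.mem_insert _ _)
    omega

theorem reachSet_connected {W : Set V} {v u : V} (hv : v ∈ W) (hu : u ∈ reachSet G W v) :
    reachSet G W v ⊆ reachSet G (reachSet G W v) u := by
  have := reachSet_reachSet (G := G) hv
  exact fun w hw => reachSet_trans (reachSet_symm (this hu)) (this hw)

/-- If the component meets `R`, a component of `G[R]` in it serves as hub. If not, any of its
vertices is a suitable cut vertex, because deleting it leaves only smaller pieces. -/
theorem exists_isShedding_of_component [Finite V] (hG : NeighborsClosed G) {r : ℕ} {W R : Set V}
    (hRW : R ⊆ W) (hR : SmallComps G r R) {x : V} (hx : x ∈ W)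
    (hcard : r < (reachSet G W x).ncard)
    (hmin : ∀ z ∈ W, z ∉ R → ∀ v ∈ W, v ≠ z → reachSet G (W \ {z}) v ⊂ reachSet G W x →
      (reachSet G (W \ {z}) v).ncard ≤ r) :
    ∃ x, IsShedding G r W R x := by
  have hXW : reachSet G W x ⊆ W := reachSet_subset hx
  by_cases hXR : ∃ p ∈ reachSet G W x, p ∈ R
  · obtain ⟨p, hpX, hpR⟩ := hXR
    refine exists_isShedding_of_hub hG hR hXW (fun v hv => reachSet_connected hx hv) hcard hmin
      (mem_reachSet_self R p) ((reachSet_subset hpR).trans hRW) (reachSet_reachSet hpR)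
      (fun h hh z _ hhz hz hzR => hz (reachSet_step hh (reachSet_subset hpR hh) hzR hhz))
      ⟨p, hpX, Or.inl (mem_reachSet_self _ _)⟩ (fun z _ _ _ v hv => ?_)
      (Or.inl (reachSet_subset hpR))
    rw [← reachSet_eq hpX]
    exact hv.1
  · push Not at hXR
    have hins : insert x (reachSet G W x \ {x}) = reachSet G W x :=
      Set.insert_sdiff_self_of_mem (mem_reachSet_self _ _)
    have hxR := hXR x (mem_reachSet_self _ _)
    refine ⟨x, isShedding_of_cut (S := reachSet G W x \ {x}) hx hxR (fun h => h.2 rfl)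
      (fun v hv => hXW hv.1) ?_ (fun v hv => ?_) ?_⟩
    · rw [hins]
      exact fun v hv => reachSet_reachSet hx hv.1
    · refine hmin x hx hxR v (hXW hv.1) hv.2 ⟨?_, fun h => ?_⟩
      · rw [← reachSet_eq hv.1]
        exact reachSet_mono Set.sdiff_subset v
      · exact (reachSet_subset (show v ∈ W \ {x} from ⟨hXW hv.1, hv.2⟩)
          (h (mem_reachSet_self _ _))).2 rfl
    · rwa [hins]

/-- Minimality over pairs `(y, x)` means that deleting a vertex outside `R` leaves no large
component properly inside `X`. The hub is chosen by how `y` is attached to `X`: no edge makes `X` a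
component of `G[W]`, a neighbour in `R` gives a component of `G[R]`, and otherwise `{y}` is used. -/
theorem exists_isShedding [Finite V] (hG : NeighborsClosed G) {r : ℕ} {W R : Set V}
    (hRW : R ⊆ W) (hR : SmallComps G r R) (hW : ¬ SmallComps G r W) :
    ∃ x, IsShedding G r W R x := by
  by_cases hbig : ∃ q : V × V, q.1 ∈ W ∧ q.1 ∉ R ∧ q.2 ∈ W ∧ q.2 ≠ q.1 ∧
      r < (reachSet G (W \ {q.1}) q.2).ncard
  swap
  · push Not at hbig
    rw [SmallComps] at hW
    push Not at hW
    obtain ⟨x, hx, hcard⟩ := hW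
    exact exists_isShedding_of_component hG hRW hR hx hcard
      fun z hz hzR v hv hvz _ => hbig (z, v) hz hzR hv hvz
  obtain ⟨⟨y, x⟩, ⟨hyW, hyR, hxW, hxy, hcard⟩, hmin⟩ := exists_minimalFor_of_wellFoundedLT _
    (fun q : V × V => (reachSet G (W \ {q.1}) q.2).ncard) hbig
  dsimp only at hyW hyR hxW hxy hcard hmin
  have hmin' : ∀ z ∈ W, z ∉ R → ∀ v ∈ W, v ≠ z →
      reachSet G (W \ {z}) v ⊂ reachSet G (W \ {y}) x →
      (reachSet G (W \ {z}) v).ncard ≤ r := by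
    intro z hz hzR v hv hvz hss
    by_contra! hlt
    have h1 := Set.ncard_lt_ncard hss (Set.toFinite _)
    have h2 := hmin (j := (z, v)) ⟨hz, hzR, hv, hvz, hlt⟩ h1.le
    dsimp only at h2
    omega
  have hxWy : x ∈ W \ {y} := ⟨hxW, hxy⟩
  set X := reachSet G (W \ {y}) x with hX
  have hXWy : X ⊆ W \ {y} := reachSet_subset hxWy
  have hXW : X ⊆ W := fun v hv => (hXWy hv).1
  have hyX : y ∉ X := fun h => (hXWy h).2 rfl
  have hXconn : ∀ v ∈ X, X ⊆ reachSet G X v := fun v hv => reachSet_connected hxWy hv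
  by_cases hQ : ∃ q ∈ X, G.Adj y q
  swap
  · push Not at hQ
    have hXeq : X = reachSet G W x := by
      refine Set.Subset.antisymm (reachSet_mono Set.sdiff_subset x) ?_
      refine reachSet_subset_of_closed (mem_reachSet_self _ _) fun a ha haW b hb hab => ?_
      have hby : b ≠ y := by
        rintro rfl
        exact hQ a ha hab.symm
      exact reachSet_step ha (hXWy ha) ⟨hb, hby⟩ hab
    rw [hXeq] at hmin' hcard
    exact exists_isShedding_of_component hG hRW hR hxW hcard hmin'
  have hbranch : ∀ p ∈ W, ∀ z ∈ X, z ∈ branch G W p z → y ∉ branch G W p z →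
      branch G W p z ⊆ X := by
    intro p hp z hz hzB hyB v hv
    rw [hX, ← reachSet_eq hz]
    have hsub : branch G W p z ⊆ W \ {y} := fun w hw =>
      ⟨branch_subset hp hw, fun h => hyB (h ▸ hw)⟩
    exact reachSet_mono hsub z (branch_subset_reachSet hzB hv)
  by_cases hQR : ∃ p ∈ X, G.Adj y p ∧ p ∈ R
  · obtain ⟨p, hpX, hyp, hpR⟩ := hQR
    have hHW : reachSet G R p ⊆ W := (reachSet_subset hpR).trans hRW
    refine exists_isShedding_of_hub hG hR hXW hXconn hcard hmin'
      (mem_reachSet_self R p) hHW (reachSet_reachSet hpR)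
      (fun h hh z _ hhz hz hzR => hz (reachSet_step hh (reachSet_subset hpR hh) hzR hhz))
      ⟨p, hpX, Or.inl (mem_reachSet_self _ _)⟩ ?_ (Or.inl (reachSet_subset hpR))
    rintro z hz hzH ⟨h, hh, hhz⟩
    have hzp : z ≠ p := fun h' => hzH (h' ▸ mem_reachSet_self _ _)
    have hpW := hRW hpR
    refine hbranch p hpW z hz (mem_branch_self hpW hzp
      (reachSet_step (reachSet_mono hRW p hh) (hHW hh) (hXW hz) hhz)) fun hyB => hyB.2 ?_
    -- The edge from `y` to `p` survives the deletion of `z`, so `y` is outside the branch, which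
    -- therefore stays in `X`.
    exact reachSet_step (mem_reachSet_self _ _) ⟨hpW, hzp.symm⟩
      ⟨hyW, fun h' => hyX (h' ▸ hz)⟩ hyp.symm
  · push Not at hQR
    obtain ⟨q, hqX, hyq⟩ := hQ
    refine exists_isShedding_of_hub (H := {y}) (p := y) hG hR hXW hXconn hcard hmin' rfl
      (Set.singleton_subset_iff.2 hyW) (Set.singleton_subset_iff.2 (mem_reachSet_self _ _))
      ?_ ⟨q, hqX, Or.inr ⟨y, rfl, hyq⟩⟩ ?_
      (Or.inr ⟨Set.disjoint_singleton_left.2 hyX, ?_⟩)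
    · rintro _ rfl z hz hyz -
      exact hQR z hz hyz
    · rintro z hz hzy ⟨_, rfl, hyz⟩
      exact hbranch _ hyW z hz (mem_branch_self hyW hzy
        (reachSet_step (mem_reachSet_self _ _) hyW (hXW hz) hyz))
        fun hyB => hyB.2 (mem_reachSet_self _ _)
    · rintro z hz z' hz' ⟨_, rfl, hyz⟩ ⟨_, rfl, hyz'⟩ hne
      -- Two roots are neighbours of `y` joined inside `X`, hence without `y`, so they are adjacent.
      refine (hG (W \ {_}) _ z z' (fun h => h.2 rfl) hyz hyz' ?_).resolve_left hne
      exact reachSet_trans (reachSet_symm hz) hz'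

end Shedding

/-! ### Shellings from rank functions and shedding vertices. -/

section RankShelling

variable {V : Type*}

/-- Shellability in terms of a rank function that orders the facets: whenever `F'` precedes `F`,
some facet preceding `F` contains all of `F` except one vertex outside `F'`. -/
def RankShellable (Δ : LowerSet (Finset V)) : Prop :=
  ∃ f : Finset V → ℕ,
    (∀ F F', IsFacet Δ F → IsFacet Δ F' → f F = f F' → F = F') ∧
    ∀ F F', IsFacet Δ F → IsFacet Δ F' → f F' < f F →
      ∃ F'', IsFacet Δ F'' ∧ f F'' < f F ∧ ∃ v ∈ F, v ∉ F' ∧ ∀ w ∈ F, w ≠ v → w ∈ F''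

theorem RankShellable.of_subsingleton {Δ : LowerSet (Finset V)}
    (h : ∀ F F', IsFacet Δ F → IsFacet Δ F' → F = F') : RankShellable Δ :=
  ⟨fun _ => 0, fun F F' hF hF' _ => h F F' hF hF', fun _ _ _ _ hlt => absurd hlt (lt_irrefl _)⟩

theorem exists_isFacet_of_mem [Finite V] {Δ : LowerSet (Finset V)} {E : Finset V} (hE : E ∈ Δ) :
    ∃ F, E ⊆ F ∧ IsFacet Δ F :=
  (Set.toFinite {F | F ∈ Δ}).exists_le_maximal hE

theorem RankShellable.shellable [Finite V] {Δ : LowerSet (Finset V)} (h : RankShellable Δ) :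
    Shellable Δ := by
  classical
  obtain ⟨f, hinj, hf⟩ := h
  let s : Finset ℕ := ((Set.toFinite {F | IsFacet Δ F}).toFinset).image f
  have hs : ∀ {n}, n ∈ s ↔ ∃ F, IsFacet Δ F ∧ f F = n := by simp [s]
  let e := s.orderEmbOfFin rfl
  have he : ∀ k, ∃ F, IsFacet Δ F ∧ f F = e k := fun k => hs.1 (s.orderEmbOfFin_mem rfl k)
  choose F hF hfF using he
  have hsurj : ∀ E, IsFacet Δ E → ∃ k, F k = E := by
    intro E hE
    have : f E ∈ Set.range e := by
      rw [Finset.range_orderEmbOfFin]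
      exact hs.2 ⟨E, hE, rfl⟩
    obtain ⟨k, hk⟩ := this
    exact ⟨k, hinj _ _ (hF k) hE ((hfF k).trans hk)⟩
  have hlt : ∀ j k, f (F j) < f (F k) ↔ j < k := fun j k => by
    rw [hfF, hfF]
    exact e.lt_iff_lt
  refine ⟨s.card, F, fun j k hjk => e.injective (by rw [← hfF, ← hfF, hjk]),
    fun E => ⟨hsurj E, fun ⟨k, hk⟩ => hk ▸ hF k⟩, fun k _ E hE => ?_⟩
  have hmem : ∀ A, A ∈ (LowerSet.Iic (F k) ⊓ ⨆ j : {j // j < k}, LowerSet.Iic (F j)) ↔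
      A ⊆ F k ∧ ∃ j, j < k ∧ A ⊆ F j := by
    intro A
    simp [LowerSet.mem_iSup_iff]
  obtain ⟨hEk, j, hjk, hEj⟩ := (hmem E).1 hE.prop
  obtain ⟨F'', hF'', hlt'', v, hvF, hvj, hsub⟩ := hf _ _ (hF k) (hF j) ((hlt j k).2 hjk)
  obtain ⟨m, rfl⟩ := hsurj F'' hF''
  have hin : (F k).erase v ∈ (LowerSet.Iic (F k) ⊓ ⨆ j : {j // j < k}, LowerSet.Iic (F j)) :=
    (hmem _).2 ⟨Finset.erase_subset _ _, m, (hlt m k).1 hlt'', fun w hw =>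
      hsub w (Finset.mem_of_mem_erase hw) (Finset.ne_of_mem_erase hw)⟩
  -- A facet `E` of the intersection lies in some `F j`, so it misses `v`; as `(F k).erase v` is
  -- itself in the intersection, the two coincide.
  have hle : E ≤ (F k).erase v := Finset.subset_erase.2 ⟨hEk, fun hv => hvj (hEj hv)⟩
  rw [le_antisymm hle (hE.le_of_ge hin hle), Finset.card_erase_of_mem hvF]

/-- Shelling the deletion of a shedding vertex and then the star shells the whole complex. -/
theorem RankShellable.of_shedding [Finite V] [DecidableEq V] {Δ D L : LowerSet (Finset V)} {x : V}
    (hD : ∀ A, A ∈ D ↔ A ∈ Δ ∧ x ∉ A) (hL : ∀ A, A ∈ L ↔ x ∉ A ∧ insert x A ∈ Δ)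
    (hshed : ∀ F ∈ L, ¬ IsFacet D F) (sD : RankShellable D) (sL : RankShellable L) :
    RankShellable Δ := by
  have facetD : ∀ F, x ∉ F → IsFacet Δ F → IsFacet D F := fun F hx hF =>
    ⟨(hD F).2 ⟨hF.prop, hx⟩, fun E hE hle => hF.le_of_ge ((hD E).1 hE).1 hle⟩
  have facetD' : ∀ F, IsFacet D F → x ∉ F ∧ IsFacet Δ F := by
    intro F hF
    obtain ⟨hFΔ, hx⟩ := (hD F).1 hF.prop
    refine ⟨hx, hFΔ, fun E hE hle => ?_⟩
    by_cases hxE : x ∈ E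
    · have : insert x F ∈ Δ := Δ.lower (Finset.insert_subset hxE hle) hE
      exact absurd hF (hshed F ((hL F).2 ⟨hx, this⟩))
    · exact hF.le_of_ge ((hD E).2 ⟨hE, hxE⟩) hle
  have facetL : ∀ F, x ∈ F → IsFacet Δ F → IsFacet L (F.erase x) := by
    intro F hx hF
    refine ⟨(hL _).2 ⟨Finset.notMem_erase _ _, by rw [Finset.insert_erase hx]; exact hF.prop⟩,
      fun E hE hle => ?_⟩
    obtain ⟨hxE, hE'⟩ := (hL E).1 hE
    have h1 : F ≤ insert x E := Finset.subset_insert_iff.2 hle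
    exact Finset.subset_erase.2
      ⟨(Finset.subset_insert _ _).trans (hF.le_of_ge hE' h1), hxE⟩
  have facetL' : ∀ F, IsFacet L F → x ∉ F ∧ IsFacet Δ (insert x F) := by
    intro F hF
    obtain ⟨hx, hFΔ⟩ := (hL F).1 hF.prop
    refine ⟨hx, hFΔ, fun E hE hle => ?_⟩
    have hxE : x ∈ E := hle (Finset.mem_insert_self _ _)
    have h1 : E.erase x ∈ L :=
      (hL _).2 ⟨Finset.notMem_erase _ _, by rwa [Finset.insert_erase hxE]⟩
    have h2 : F ≤ E.erase x :=
      Finset.subset_erase.2 ⟨(Finset.subset_insert _ _).trans hle, hx⟩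
    exact Finset.subset_insert_iff.2 (hF.le_of_ge h1 h2)
  obtain ⟨f, finj, hf⟩ := sD
  obtain ⟨g, ginj, hg⟩ := sL
  -- Shifting by `N` places all facets containing `x` after those avoiding it.
  obtain ⟨N, hN⟩ : ∃ N, ∀ F, f F < N := by
    obtain ⟨N, hN⟩ := (Set.finite_range f).bddAbove
    exact ⟨N + 1, fun F => Nat.lt_succ_of_le (hN ⟨F, rfl⟩)⟩
  refine ⟨fun F => if x ∈ F then N + g (F.erase x) else f F, ?_, ?_⟩
  · intro F F' hF hF' h
    by_cases hx : x ∈ F <;> by_cases hx' : x ∈ F' <;> simp only [hx, hx', if_true, if_false] at h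
    · have := ginj _ _ (facetL F hx hF) (facetL F' hx' hF') (by omega)
      rw [← Finset.insert_erase hx, this, Finset.insert_erase hx']
    · have := hN F'
      omega
    · have := hN F
      omega
    · exact finj _ _ (facetD F hx hF) (facetD F' hx' hF') h
  · intro F F' hF hF' h
    by_cases hx : x ∈ F <;> by_cases hx' : x ∈ F' <;> simp only [hx, hx', if_true, if_false] at h ⊢
    · obtain ⟨E, hE, hlt, v, hv, hv', hsub⟩ :=
        hg _ _ (facetL F hx hF) (facetL F' hx' hF') (by omega)
      obtain ⟨hxE, hE'⟩ := facetL' E hE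
      have hvx := Finset.ne_of_mem_erase hv
      refine ⟨insert x E, hE', ?_, v, Finset.mem_of_mem_erase hv,
        fun h' => hv' (Finset.mem_erase.2 ⟨hvx, h'⟩), fun w hw hwv => ?_⟩
      · rw [if_pos (Finset.mem_insert_self _ _), Finset.erase_insert hxE]
        omega
      · by_cases hwx : w = x
        · exact Finset.mem_insert.2 (Or.inl hwx)
        · exact Finset.mem_insert_of_mem (hsub w (Finset.mem_erase.2 ⟨hwx, hw⟩) hwv)
    -- The mixed case: any facet of the deletion containing `F.erase x` is an earlier facet of `Δ`
    -- by the shedding condition, and the vertex given up is `x`.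
    · have hmem : F.erase x ∈ D :=
        (hD _).2 ⟨Δ.lower (Finset.erase_subset _ _) hF.prop, Finset.notMem_erase _ _⟩
      obtain ⟨E, hle, hE⟩ := exists_isFacet_of_mem hmem
      obtain ⟨hxE, hE'⟩ := facetD' E hE
      refine ⟨E, hE', ?_, x, hx, hx', fun w hw hwx => hle (Finset.mem_erase.2 ⟨hwx, hw⟩)⟩
      rw [if_neg hxE]
      have := hN E
      omega
    · have := hN F
      omega
    · obtain ⟨E, hE, hlt, v, hv⟩ := hf _ _ (facetD F hx hF) (facetD F' hx' hF') h
      obtain ⟨hxE, hE'⟩ := facetD' E hE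
      exact ⟨E, hE', by rwa [if_neg hxE], v, hv⟩

end RankShelling

/-! ### Vertex decomposition of the relative independence complexes. -/

section IndependenceComplex

variable {V : Type*}

/-- The sets `A ⊆ U` such that all components of `G[A ∪ R]` have at most `r` vertices. -/
def relIndComplex [Finite V] (G : SimpleGraph V) (r : ℕ) (U R : Finset V) :
    LowerSet (Finset V) where
  carrier := {A | A ⊆ U ∧ SmallComps G r (A ∪ R : Set V)}
  lower' := fun _ _ hBA hA =>
    ⟨hBA.trans hA.1, hA.2.mono (Set.union_subset_union_left _ (Finset.coe_subset.2 hBA))⟩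

theorem mem_relIndComplex [Finite V] {G : SimpleGraph V} {r : ℕ} {U R A : Finset V} :
    A ∈ relIndComplex G r U R ↔ A ⊆ U ∧ SmallComps G r (A ∪ R : Set V) :=
  Iff.rfl

theorem rankShellable_relIndComplex [Finite V] {G : SimpleGraph V} (hG : NeighborsClosed G)
    (r : ℕ) (U R : Finset V) : RankShellable (relIndComplex G r U R) := by
  classical
  induction U using Finset.strongInduction generalizing R with
  | H U ih =>
  by_cases hR : SmallComps G r (R : Set V)
  swap
  -- Here the complex has no faces at all, not even the empty one; links can take this form.
  · exact RankShellable.of_subsingleton fun F _ hF _ =>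
      absurd (hF.prop.2.mono Set.subset_union_right) hR
  by_cases hU : SmallComps G r (U ∪ R : Set V)
  · have hmax : ∀ F, IsFacet (relIndComplex G r U R) F → F = U := fun F hF =>
      le_antisymm hF.prop.1 (hF.le_of_ge (mem_relIndComplex.2 ⟨subset_rfl, hU⟩) hF.prop.1)
    exact RankShellable.of_subsingleton fun F F' hF hF' => (hmax F hF).trans (hmax F' hF').symm
  obtain ⟨x, hxU, hxR, hx⟩ := exists_isShedding hG Set.subset_union_right hR hU
  replace hxU : x ∈ U := hxU.resolve_right hxR
  refine RankShellable.of_shedding (x := x) (D := relIndComplex G r (U.erase x) R)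
    (L := relIndComplex G r (U.erase x) (insert x R)) ?_ ?_ ?_
    (ih _ (Finset.erase_ssubset hxU) _) (ih _ (Finset.erase_ssubset hxU) _)
  · intro A
    rw [mem_relIndComplex, mem_relIndComplex, Finset.subset_erase]
    tauto
  · intro A
    rw [mem_relIndComplex, mem_relIndComplex, Finset.subset_erase, Finset.insert_subset_iff,
      Finset.coe_insert, Finset.coe_insert, Set.union_insert, Set.insert_union]
    tauto
  -- The shedding property, applied to `F ∪ R`, yields a vertex that extends `F` within the
  -- deletion, so `F` is not a facet there.
  · rintro F ⟨hFU, hF⟩ hfacet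
    rw [Finset.coe_insert, Set.union_insert] at hF
    obtain ⟨hFU', hxF⟩ := Finset.subset_erase.1 hFU
    obtain ⟨u, huW, hu, hux, hsmall⟩ := hx _ Set.subset_union_right
      (Set.union_subset_union_left _ (Finset.coe_subset.2 hFU'))
      (fun h => h.elim hxF hxR) hF
    have huU : u ∈ U := huW.resolve_right fun h => hu (Or.inr h)
    have hmem : insert u F ∈ relIndComplex G r (U.erase x) R := by
      refine ⟨Finset.insert_subset (Finset.mem_erase.2 ⟨hux, huU⟩) hFU, ?_⟩
      rwa [Finset.coe_insert, Set.insert_union]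
    exact hu (Or.inl (hfacet.le_of_ge hmem (Finset.subset_insert _ _)
      (Finset.mem_insert_self _ _)))

theorem shellable_indComplex [Finite V] {G : SimpleGraph V} (hG : NeighborsClosed G) (r : ℕ) :
    Shellable (indComplex G r) := by
  have := Fintype.ofFinite V
  have h : indComplex G r = relIndComplex G r Finset.univ ∅ := by
    ext A
    change IsRIndependent G r A ↔ A ⊆ Finset.univ ∧ SmallComps G r (A ∪ (∅ : Finset V) : Set V)
    rw [isRIndependent_iff, Finset.coe_empty, Set.union_empty]
    exact ⟨fun h => ⟨Finset.subset_univ _, h⟩, fun h => h.2⟩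
  rw [h]
  exact (rankShellable_relIndComplex hG r _ _).shellable

end IndependenceComplex

end BlockInd

theorem theorem4p14 {V : Type*} [Finite V] (G : SimpleGraph V) (hG : BlockInd.IsT2 G) :
    BlockInd.Shellable (BlockInd.indComplex G 4) :=
  BlockInd.shellable_indComplex (BlockInd.neighborsClosed_of_components fun C => (hG C).2.1) 4
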